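/- Let $\mathcal H$ be a finite-dimensional real Hilbert space, $\Sigma\subseteq\mathcal H$ and $R:\mathcal H\to\mathbb R$. Let $$\mathcal T_R(\Sigma)=\bigcup_{x\in\Sigma}\{\gamma z:\ \gamma\in\mathbb R,\ z\in\mathcal H,\ R(x+z)\le R(x)\}$$ be the (symmetrized) descent cone of $R$ on $\Sigma$. For a linear map $M$ on $\mathcal H$ put $$\delta_\Sigma(M)=\sup_{x\in(\Sigma-\Sigma)\setminus\{0\}}\left|\frac{\|Mx\|^2}{\|x\|^2}-1\right|,\qquad \delta^{\mathrm{nec}}_\Sigma(R)=\inf_{z\in\mathcal T_R(\Sigma)\setminus\{0\}}\delta_\Sigma(I-\Pi_z),$$ where $\Pi_z$ is the orthogonal projection onto $\mathrm{span}(z)$. Let $k_1,k_2\ge2$, $n_1\ge4k_1$ and $n_2\ge4k_2$ be integers. Let $\mathcal H=\mathbb R^{n_1}\times\mathbb R^{n_2}$ with its Euclidean norm, and let $\Sigma=\Sigma_{k_1,k_2}$ be the set of all $(x_1,x_2)\in\mathcal H$ such that $x_i$ has at most $k_i$ nonzero entries for $i=1,2$. For $w_1,w_2>0$ let $\|(x_1,x_2)\|_{(w_1,w_2)}=w_1\|x_1\|_1+w_2\|x_2\|_1$.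 Let $\tilde a=2\sqrt3-3$ and, for $\nu_1\in[\tilde a,1-\tilde a]$ and $\nu_2=1-\nu_1$, let $$F(\nu_1)=\max_{i\in\{1,2\}}\ \max_{x_i\in\left\{\lfloor k_i\sqrt{1+1/\nu_i}\rfloor,\ \lceil k_i\sqrt{1+1/\nu_i}\rceil\right\}}\frac{x_i/k_i}{\nu_i(x_i/k_i+1)^2+1}.$$ Then $F$ attains its minimum on $[\tilde a,1-\tilde a]$, and for every minimizer $\nu_1^*$ of $F$ on $[\tilde a,1-\tilde a]$ and all $w_1^*,w_2^*>0$, $$(w_1^*,w_2^*)\in\operatorname*{arg\,max}_{w_1,w_2>0}\ \delta^{\mathrm{nec}}_\Sigma\big(\|\cdot\|_{(w_1,w_2)}\big)\quad\Longleftrightarrow\quad\frac{w_2^*}{w_1^*}=\sqrt{\frac{k_1}{k_2}\left(\frac1{\nu_1^*}-1\right)}.$$ -/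

import Mathlib

open scoped InnerProductSpace Pointwise

noncomputable section

/-- The (symmetrized) descent cone of `R` at `x`: all `γ z` with `γ` real and `R (x + z) ≤ R x`. -/
def descentCone {E : Type*} [AddCommGroup E] [Module ℝ E] (R : E → ℝ) (x : E) : Set E :=
  {y | ∃ (γ : ℝ) (z : E), R (x + z) ≤ R x ∧ y = γ • z}

/-- The descent cone of `R` over a model set: the union of the descent cones at its points. -/
def descentConeOn {E : Type*} [AddCommGroup E] [Module ℝ E] (R : E → ℝ) (S : Set E) : Set E :=
  ⋃ x ∈ S, descentCone R x

/-- The restricted isometry constant of `M` on the secant set `S - S`. The supremum runs over the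
nonzero elements of `S - S`, where the quotient makes sense. -/
def ripConst {E F : Type*} [NormedAddCommGroup E] [NormedSpace ℝ E]
    [NormedAddCommGroup F] [NormedSpace ℝ F] (S : Set E) (M : E →L[ℝ] F) : ℝ :=
  ⨆ x : {x : E // x ∈ S - S ∧ x ≠ 0}, |‖M x‖ ^ 2 / ‖(x : E)‖ ^ 2 - 1|

/-- The compliance measure `δ^nec_S(R)`: the infimum over the nonzero `z` in the descent cone of `R`
on `S` of the restricted isometry constant of `I - Π_z`, where `Π_z` is the orthogonal projection
onto the line spanned by `z`. -/
def deltaNec {E : Type*} [NormedAddCommGroup E] [InnerProductSpace ℝ E]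
    (S : Set E) (R : E → ℝ) : ℝ :=
  ⨅ z : {z : E // z ∈ descentConeOn R S ∧ z ≠ 0},
    ripConst S (ContinuousLinearMap.id ℝ E - (ℝ ∙ (z : E)).starProjection)

/-- The Hilbert space `ℝ^{n_1} × ⋯ × ℝ^{n_L}`, with the Euclidean norm. -/
abbrev LevelSpace {L : ℕ} (n : Fin L → ℕ) : Type :=
  PiLp 2 fun i : Fin L => EuclideanSpace ℝ (Fin (n i))

/-- The `k`-sparse vectors of `ℝ^n`. -/
def sparseModel (n k : ℕ) : Set (EuclideanSpace ℝ (Fin n)) :=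
  {x | {j | x j ≠ 0}.ncard ≤ k}

/-- Sparsity in levels: the `i`-th block is `k_i`-sparse. -/
def sparseInLevels {L : ℕ} (n k : Fin L → ℕ) : Set (LevelSpace n) :=
  {x | ∀ i, x i ∈ sparseModel (n i) (k i)}

/-- The `ℓ¹`-norm weighted by levels, `∑ i, w_i ‖x_i‖_1`. -/
def levelNorm {L : ℕ} (n : Fin L → ℕ) (w : Fin L → ℝ) (x : LevelSpace n) : ℝ :=
  ∑ i, w i * ∑ j, |x i j|

/-- `(x/k) / (ν (x/k + 1)² + 1)`. -/
def levelRatio (k : ℕ) (ν : ℝ) (x : ℕ) : ℝ :=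
  ((x : ℝ) / k) / (ν * ((x : ℝ) / k + 1) ^ 2 + 1)

/-- The larger of the values of `levelRatio k ν` at the two integer roundings of
`k √(1 + 1/ν)`. -/
def levelMax (k : ℕ) (ν : ℝ) : ℝ :=
  max (levelRatio k ν ⌊(k : ℝ) * √(1 + 1 / ν)⌋₊) (levelRatio k ν ⌈(k : ℝ) * √(1 + 1 / ν)⌉₊)

/-- The objective in `ν_1`, with `ν_2 = 1 - ν_1`. -/
def levelObjective (k : Fin 2 → ℕ) (ν : ℝ) : ℝ :=
  max (levelMax (k 0) ν) (levelMax (k 1) (1 - ν))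

end

/-!
For a direction `z`, the isometry defect of the projection off `z` at `x` is the squared cosine of
the angle between `x` and `z`, so on `Σ - Σ` (vectors with at most `2 k_i` nonzero entries in level
`i`) its supremum is the largest share of the energy of `z` that such a support can carry. The
compliance measure of the weighted norm is the smallest such share along the descent cone, where
`z` has, up to a scalar, at least as much weighted `ℓ¹`-mass on supports of sizes `k_i` (the heads)
as off them. Put `ν_i = w_i² k_i / ∑ w_l² k_l` (`levelShare`).

*Lower bound* (`levelObjective_le_deltaNec`). Next to the heads, take the `k_i` largest remaining
entries of each level. By convexity in each coordinate the remaining tail is worst when its entries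
are `0` or equal to the smallest of those `k_i` entries, which in one level gives the ratio
`(x/k) / (ν (x/k + 1)² + 1)` for an integer `x` (`tail_sq_le`). The levels add up because the cross
terms in the square of the total mass are nonnegative, and Cauchy–Schwarz bounds that square by the
energy of the heads. Hence the measure is at least `1 / (1 + F(ν_0))`, for all weights.

*Upper bound*. If the whole tail is put in one level and the heads are proportional to the weights,
all these inequalities are equalities for the best `x` (`deltaNec_le_levelRatio`), if that head
still dominates the tail. This holds for shares in `[2√3 - 3, 1 - (2√3 - 3)]`, so there the measure
equals `1 / (1 + F(ν_0))`. For a smaller share, `3 k_i` equal entries off the head already push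
the measure below `1 / (1 + (√3 - 1)/2)` (`deltaNec_lt_of_share_small`), whereas
`F(1/2) ≤ (√3 - 1)/2`.

Finally `F` is the maximum of a strictly decreasing and a strictly increasing continuous function,
so it has exactly one minimizer, and the measure is maximal exactly for the weights whose share is
that minimizer.
-/

/-! ### The ratio in one level -/

theorem levelRatio_nonneg (k : ℕ) {ν : ℝ} (hν : 0 ≤ ν) (x : ℕ) : 0 ≤ levelRatio k ν x := by
  unfold levelRatio; positivity

/-- The threshold at which the ratio turns: for `a ≤ b`, the ratio grows from `a` to `b`
exactly when the product `a b` does not exceed `1 + 1/ν`. -/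
theorem ratio_sub_ratio {ν : ℝ} (hν : 0 < ν) (a b : ℝ) :
    b / (ν * (b + 1) ^ 2 + 1) - a / (ν * (a + 1) ^ 2 + 1) =
      (b - a) * (ν + 1 - ν * (a * b)) /
        ((ν * (b + 1) ^ 2 + 1) * (ν * (a + 1) ^ 2 + 1)) := by
  have h1 : ν * (b + 1) ^ 2 + 1 ≠ 0 := by positivity
  have h2 : ν * (a + 1) ^ 2 + 1 ≠ 0 := by positivity
  rw [div_sub_div _ _ h1 h2]
  congr 1
  ring

theorem mul_sqrt_sq {k : ℕ} (hk : 0 < k) {ν : ℝ} (hν : 0 < ν) :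
    ((k : ℝ) * √(1 + 1 / ν)) ^ 2 * ν = (ν + 1) * k ^ 2 := by
  rw [mul_pow, Real.sq_sqrt (by positivity)]
  field_simp

/-- The ratio is unimodal in the integer argument, with real peak at `k √(1 + 1/ν)`, so the larger
of its values at the two roundings of the peak bounds all its values. -/
theorem levelRatio_le_levelMax {k : ℕ} (hk : 0 < k) {ν : ℝ} (hν : 0 < ν) (x : ℕ) :
    levelRatio k ν x ≤ levelMax k ν := by
  have hk' : (0 : ℝ) < k := by exact_mod_cast hk
  set s : ℝ := (k : ℝ) * √(1 + 1 / ν) with hs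
  have hs0 : 0 ≤ s := by positivity
  have hsq : s ^ 2 * ν = (ν + 1) * k ^ 2 := mul_sqrt_sq hk hν
  have key : ∀ a b : ℕ, 0 ≤ ((b : ℝ) - a) * (s ^ 2 - a * b) →
      levelRatio k ν a ≤ levelRatio k ν b := by
    intro a b h
    rw [← sub_nonneg]
    unfold levelRatio
    rw [ratio_sub_ratio hν]
    apply div_nonneg _ (by positivity)
    have e : ((b : ℝ) / k - a / k) * (ν + 1 - ν * (a / k * (b / k))) =
        ((b : ℝ) - a) * (s ^ 2 - a * b) * ν / k ^ 3 := by
      have : ν + 1 = s ^ 2 * ν / k ^ 2 := by rw [hsq]; field_simp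
      rw [this]; field_simp
    rw [e]; positivity
  unfold levelMax
  rw [← hs]
  rcases le_total (x : ℝ) s with h | h
  · refine le_max_of_le_left (key _ _ ?_)
    have h1 : x ≤ ⌊s⌋₊ := Nat.le_floor h
    have h2 : (⌊s⌋₊ : ℝ) ≤ s := Nat.floor_le hs0
    have h3 : (x : ℝ) ≤ ⌊s⌋₊ := by exact_mod_cast h1
    refine mul_nonneg (by linarith) ?_
    have := mul_le_mul h h2 (by positivity) hs0
    nlinarith
  · refine le_max_of_le_right (key _ _ ?_)
    have h1 : ⌈s⌉₊ ≤ x := Nat.ceil_le.2 h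
    have h2 : s ≤ (⌈s⌉₊ : ℝ) := Nat.le_ceil s
    have h3 : ((⌈s⌉₊ : ℕ) : ℝ) ≤ x := by exact_mod_cast h1
    refine mul_nonneg_of_nonpos_of_nonpos (by linarith) ?_
    have := mul_le_mul h h2 hs0 (by positivity)
    nlinarith

theorem levelMax_nonneg (k : ℕ) {ν : ℝ} (hν : 0 ≤ ν) : 0 ≤ levelMax k ν :=
  le_max_of_le_left (levelRatio_nonneg k hν _)

theorem le_mul_sqrt {k : ℕ} {ν : ℝ} (hν : 0 < ν) : (k : ℝ) ≤ k * √(1 + 1 / ν) := by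
  refine le_mul_of_one_le_right (by positivity) (Real.one_le_sqrt.2 ?_)
  have : 0 < 1 / ν := by positivity
  linarith

/-- The maximum is attained at a rounding of the peak; for `ν ≥ 1/3` it lies in `[1, 2k]`. -/
theorem exists_levelMax_eq {k : ℕ} {ν : ℝ} (hν : 0 < ν) :
    ∃ x : ℕ, levelMax k ν = levelRatio k ν x ∧ k ≤ x ∧
      (k : ℝ) * √(1 + 1 / ν) - 1 ≤ x ∧ (1 / 3 ≤ ν → x ≤ 2 * k) := by
  have hlow := le_mul_sqrt (k := k) hν
  have hs0 : 0 ≤ (k : ℝ) * √(1 + 1 / ν) := by positivity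
  have hup : 1 / 3 ≤ ν → (k : ℝ) * √(1 + 1 / ν) ≤ (2 * k : ℕ) := by
    intro h
    have : 1 / ν ≤ 3 := by rw [div_le_iff₀ hν]; linarith
    have : √(1 + 1 / ν) ≤ 2 := by
      rw [Real.sqrt_le_left (by norm_num)]; linarith
    push_cast
    nlinarith [(Nat.cast_nonneg k : (0 : ℝ) ≤ k)]
  have hfl := Nat.lt_floor_add_one ((k : ℝ) * √(1 + 1 / ν))
  have hce := Nat.le_ceil ((k : ℝ) * √(1 + 1 / ν))
  have hk1 : k ≤ ⌊(k : ℝ) * √(1 + 1 / ν)⌋₊ := Nat.le_floor hlow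
  rcases max_choice (levelRatio k ν ⌊(k : ℝ) * √(1 + 1 / ν)⌋₊)
    (levelRatio k ν ⌈(k : ℝ) * √(1 + 1 / ν)⌉₊) with h | h
  · refine ⟨_, h, hk1, by linarith, fun h3 => ?_⟩
    exact_mod_cast (Nat.floor_le hs0).trans (hup h3)
  · exact ⟨_, h, hk1.trans (Nat.floor_le_ceil _), by linarith, fun h3 => Nat.ceil_le.2 (hup h3)⟩

theorem levelRatio_lt_of_lt {k x : ℕ} (hk : 0 < k) (hx : 0 < x) {ν μ : ℝ} (hν : 0 < ν)
    (h : ν < μ) : levelRatio k μ x < levelRatio k ν x := by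
  unfold levelRatio
  have : (0 : ℝ) < k := by exact_mod_cast hk
  have : (0 : ℝ) < x := by exact_mod_cast hx
  have hu : (0 : ℝ) < (x : ℝ) / k := by positivity
  gcongr

theorem levelMax_strictAntiOn {k : ℕ} (hk : 0 < k) : StrictAntiOn (levelMax k) (Set.Ioi 0) := by
  intro ν hν μ hμ h
  obtain ⟨x, hx, hkx, -⟩ := exists_levelMax_eq (k := k) hμ
  rw [hx]
  exact (levelRatio_lt_of_lt hk (hk.trans_le hkx) hν h).trans_le (levelRatio_le_levelMax hk hν x)

/-- Where `ν ≥ 1/3` the maximum runs over the fixed finite range `x ≤ 2k`, hence is continuous. -/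
theorem levelMax_continuousOn {k : ℕ} (hk : 0 < k) :
    ContinuousOn (levelMax k) (Set.Ici (1 / 3)) := by
  have hne : (Finset.range (2 * k + 1)).Nonempty := ⟨0, by simp⟩
  have hc : ContinuousOn (fun ν => (Finset.range (2 * k + 1)).sup' hne
      fun x => levelRatio k ν x) (Set.Ici (1 / 3)) := by
    refine ContinuousOn.finset_sup'_apply hne fun x _ => ?_
    unfold levelRatio
    refine ContinuousOn.div (by fun_prop) (by fun_prop) fun ν hν => ?_
    have : (0 : ℝ) < ν := lt_of_lt_of_le (by norm_num) hν
    positivity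
  refine hc.congr fun ν hν => ?_
  have hν0 : (0 : ℝ) < ν := lt_of_lt_of_le (by norm_num) hν
  obtain ⟨x, hx, -, -, hx2⟩ := exists_levelMax_eq (k := k) hν0
  apply le_antisymm
  · rw [hx]
    exact Finset.le_sup' (fun x => levelRatio k ν x) (by simpa [Nat.lt_succ_iff] using hx2 hν)
  · exact Finset.sup'_le _ _ fun x _ => levelRatio_le_levelMax hk hν0 x

theorem levelMax_half_le {k : ℕ} : levelMax k (1 / 2) ≤ (√3 - 1) / 2 := by
  have h3 : √3 ^ 2 = 3 := Real.sq_sqrt (by norm_num)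
  have h31 : 1 ≤ √3 := Real.one_le_sqrt.2 (by norm_num)
  have key : ∀ x, levelRatio k (1 / 2) x ≤ (√3 - 1) / 2 := by
    intro x
    unfold levelRatio
    set u : ℝ := (x : ℝ) / k
    rw [div_le_iff₀ (by positivity)]
    nlinarith [mul_nonneg (sub_nonneg.2 h31) (sq_nonneg (u - √3))]
  exact max_le (key _) (key _)

theorem mul_levelMax_le {k : ℕ} {ν : ℝ} (hν : 0 < ν) : ν * levelMax k ν ≤ 1 := by
  obtain ⟨x, hx, -⟩ := exists_levelMax_eq (k := k) hν
  rw [hx]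
  unfold levelRatio
  set u : ℝ := (x : ℝ) / k
  have hu : 0 ≤ u := by positivity
  rw [← mul_div_assoc, div_le_one (by positivity)]
  nlinarith [mul_nonneg hν.le hu, mul_nonneg hν.le (sq_nonneg u)]

/-! ### The objective -/

theorem two_sqrt_three_sub_three_bounds :
    (0.464 : ℝ) < 2 * √3 - 3 ∧ (2 * √3 - 3 : ℝ) < 0.4642 := by
  constructor
  · have : (1.732 : ℝ) < √3 := Real.lt_sqrt (by norm_num) |>.2 (by norm_num)
    linarith
  · have : √3 < (1.7321 : ℝ) := (Real.sqrt_lt' (by norm_num)).2 (by norm_num)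
    linarith

theorem levelObjective_exists_isMinOn {k : Fin 2 → ℕ} (hk : ∀ i, 0 < k i) {a : ℝ}
    (ha : 1 / 3 ≤ a) (ha' : a ≤ 1 / 2) :
    ∃ ν ∈ Set.Icc a (1 - a), IsMinOn (levelObjective k) (Set.Icc a (1 - a)) ν := by
  refine isCompact_Icc.exists_isMinOn ⟨a, by simp; linarith⟩ ?_
  unfold levelObjective
  refine ContinuousOn.sup (f := fun ν => levelMax (k 0) ν) (g := fun ν => levelMax (k 1) (1 - ν))
    ?_ ?_
  · exact (levelMax_continuousOn (hk 0)).mono fun ν hν => ha.trans hν.1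
  · exact (levelMax_continuousOn (hk 1)).comp (by fun_prop)
      fun ν hν => by simp only [Set.mem_Ici]; linarith [hν.2]

/-- The objective is the maximum of a strictly decreasing and a strictly increasing function, so
its value between two minimizers would drop below the minimum. -/
theorem levelObjective_lt_of_isMinOn {k : Fin 2 → ℕ} (hk : ∀ i, 0 < k i) {a ν μ : ℝ} (ha : 0 < a)
    (hν : ν ∈ Set.Icc a (1 - a)) (hmin : IsMinOn (levelObjective k) (Set.Icc a (1 - a)) ν)
    (hμ : μ ∈ Set.Icc a (1 - a)) (hne : μ ≠ ν) : levelObjective k ν < levelObjective k μ := by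
  refine lt_of_le_of_ne (hmin hμ) fun heq => ?_
  have key : ∀ p q : ℝ, p ∈ Set.Icc a (1 - a) → q ∈ Set.Icc a (1 - a) → p < q →
      levelObjective k p = levelObjective k ν → levelObjective k q = levelObjective k ν →
      False := by
    intro p q hp hq hpq ep eq
    have hm : levelObjective k ν ≤ levelObjective k ((p + q) / 2) :=
      hmin ⟨by linarith [hp.1], by linarith [hq.2]⟩
    have h0 : levelMax (k 0) ((p + q) / 2) < levelMax (k 0) p :=
      levelMax_strictAntiOn (hk 0) (show 0 < p by linarith [hp.1])
        (show 0 < (p + q) / 2 by linarith [hp.1]) (by linarith)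
    have h1 : levelMax (k 1) (1 - (p + q) / 2) < levelMax (k 1) (1 - q) :=
      levelMax_strictAntiOn (hk 1) (show 0 < 1 - q by linarith [hq.2])
        (show 0 < 1 - (p + q) / 2 by linarith [hq.2]) (by linarith)
    have h2 : levelMax (k 0) p ≤ levelObjective k p := le_max_left _ _
    have h3 : levelMax (k 1) (1 - q) ≤ levelObjective k q := le_max_right _ _
    exact absurd hm (not_le.2 (max_lt (by linarith) (by linarith)))
  rcases lt_or_gt_of_ne hne with h | h
  · exact key μ ν hμ hν h heq.symm rfl
  · exact key ν μ hν hμ h rfl heq.symm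

theorem levelObjective_half_le (k : Fin 2 → ℕ) : levelObjective k (1 / 2) ≤ (√3 - 1) / 2 := by
  unfold levelObjective
  rw [show (1 : ℝ) - 1 / 2 = 1 / 2 by norm_num]
  exact max_le levelMax_half_le levelMax_half_le

/-! ### The tail bound in one level -/

/-- Both sides are compared through a function that is convex in each coordinate when `A ≤ 1`, so
an inequality at the vertices of the cube `[0, 1]^s` extends to the whole cube. -/
theorem sum_sq_le_of_nat {ι : Type*} {A B c : ℝ} (hA1 : A ≤ 1)
    (h : ∀ x : ℕ, (x : ℝ) ≤ A * (c + x) ^ 2 + B) (s : Finset ι) (f : ι → ℝ)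
    (hf : ∀ i ∈ s, 0 ≤ f i ∧ f i ≤ 1) :
    ∑ i ∈ s, f i ^ 2 ≤ A * (c + ∑ i ∈ s, f i) ^ 2 + B := by
  classical
  have key : ∀ s : Finset ι, (∀ i ∈ s, 0 ≤ f i ∧ f i ≤ 1) → ∀ x : ℕ,
      x + ∑ i ∈ s, f i ^ 2 ≤ A * (c + x + ∑ i ∈ s, f i) ^ 2 + B := by
    intro s
    induction s using Finset.induction_on with
    | empty => intro _ x; simpa using h x
    | insert j s hj ih =>
      intro hf x
      have ih' := ih fun i hi => hf i (Finset.mem_insert_of_mem hi)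
      obtain ⟨h0, h1⟩ := hf j (Finset.mem_insert_self _ _)
      have e0 := ih' x
      have e1 := ih' (x + 1)
      push_cast at e1
      rw [Finset.sum_insert hj, Finset.sum_insert hj]
      set P := ∑ i ∈ s, f i ^ 2
      set S := ∑ i ∈ s, f i
      set t := f j
      -- convex combination of the two endpoints, with defect `(1 - A) t (1 - t)`
      nlinarith [mul_le_mul_of_nonneg_left e0 (sub_nonneg.2 h1), mul_le_mul_of_nonneg_left e1 h0,
        mul_nonneg (sub_nonneg.2 hA1) (mul_nonneg h0 (sub_nonneg.2 h1))]
  simpa using key s hf 0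

/-- In a level with weight fraction `ν`, the energy of the entries dominated by `k` others is
controlled by the `ℓ¹`-mass of both groups and the energy of the dominating entries. -/
theorem tail_sq_le {ι : Type*} [DecidableEq ι] {k : ℕ} (hk : 0 < k) {ν : ℝ} (hν : 0 < ν)
    (U D : Finset ι) (hU : U.card = k) (hdisj : Disjoint U D) (f : ι → ℝ) (hf : ∀ i, 0 ≤ f i)
    (hUD : ∀ i ∈ U, ∀ j ∈ D, f j ≤ f i) :
    ∑ j ∈ D, f j ^ 2 ≤
      levelMax k ν * (ν / k * (∑ j ∈ U ∪ D, f j) ^ 2 + ∑ j ∈ U, f j ^ 2) := by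
  have hk' : (0 : ℝ) < k := by exact_mod_cast hk
  have hG : 0 ≤ levelMax k ν := levelMax_nonneg k hν.le
  obtain ⟨m, hm, hmin⟩ := U.exists_min_image f (Finset.card_pos.1 (hU ▸ hk))
  set β := f m
  have hβ : 0 ≤ β := hf m
  have hS : k * β ≤ ∑ j ∈ U, f j := by
    simpa [hU] using Finset.card_nsmul_le_sum U f β hmin
  have hQ : k * β ^ 2 ≤ ∑ j ∈ U, f j ^ 2 := by
    simpa [hU] using Finset.card_nsmul_le_sum U (fun j => f j ^ 2) (β ^ 2)
      fun j hj => pow_le_pow_left₀ hβ (hmin j hj) 2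
  have hD0 : 0 ≤ ∑ j ∈ D, f j := Finset.sum_nonneg fun j _ => hf j
  have hmain : ∑ j ∈ D, f j ^ 2 ≤
      levelMax k ν * (ν / k * (k * β + ∑ j ∈ D, f j) ^ 2 + k * β ^ 2) := by
    rcases hβ.eq_or_lt with h0 | h0
    · have : ∑ j ∈ D, f j ^ 2 = 0 := Finset.sum_eq_zero fun j hj => by
        have := le_antisymm ((hUD m hm j hj).trans h0.symm.le) (hf j)
        simp [this]
      rw [this]; positivity
    · have hv := sum_sq_le_of_nat (A := levelMax k ν * (ν / k)) (B := levelMax k ν * k) (c := k)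
        ?_ ?_ D (fun j => f j / β) ?_
      · rw [← Finset.sum_div] at hv
        have e1 : ∑ j ∈ D, f j ^ 2 = β ^ 2 * ∑ j ∈ D, (f j / β) ^ 2 := by
          rw [Finset.mul_sum]
          exact Finset.sum_congr rfl fun j _ => by field_simp
        rw [e1]
        refine (mul_le_mul_of_nonneg_left hv (sq_nonneg β)).trans_eq ?_
        field_simp
      · calc levelMax k ν * (ν / k) = (ν * levelMax k ν) / k := by ring
          _ ≤ 1 / k := by gcongr; exact mul_levelMax_le hν
          _ ≤ 1 := by rw [div_le_one hk']; exact_mod_cast hk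
      · intro x
        have hx := levelRatio_le_levelMax hk hν x
        unfold levelRatio at hx
        rw [div_le_iff₀ (by positivity), div_le_iff₀ hk'] at hx
        refine hx.trans_eq ?_
        field_simp
        ring
      · intro j hj
        exact ⟨div_nonneg (hf j) hβ, (div_le_one h0).2 (hUD m hm j hj)⟩
  refine hmain.trans ?_
  rw [Finset.sum_union hdisj]
  gcongr

/-- Every finite set contains `m` elements on which `f` dominates its values on the rest. -/
theorem exists_top_subset {ι : Type*} [DecidableEq ι] (f : ι → ℝ) (C : Finset ι) {m : ℕ}
    (hm : m ≤ C.card) : ∃ U ⊆ C, U.card = m ∧ ∀ i ∈ U, ∀ j ∈ C \ U, f j ≤ f i := by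
  induction m with
  | zero => exact ⟨∅, by simp⟩
  | succ m ih =>
    obtain ⟨U, hUC, hU, hdom⟩ := ih (by omega)
    have hne : (C \ U).Nonempty := by
      rw [← Finset.card_pos, Finset.card_sdiff_of_subset hUC]; omega
    obtain ⟨b, hb, hbmax⟩ := (C \ U).exists_max_image f hne
    have hb' := Finset.mem_sdiff.1 hb
    refine ⟨insert b U, Finset.insert_subset hb'.1 hUC, by
      rw [Finset.card_insert_of_notMem hb'.2, hU], ?_⟩
    intro i hi j hj
    simp only [Finset.mem_sdiff, Finset.mem_insert, not_or] at hj
    have hj' : j ∈ C \ U := Finset.mem_sdiff.2 ⟨hj.1, hj.2.2⟩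
    rcases Finset.mem_insert.1 hi with rfl | hi
    · exact hbmax j hj'
    · exact hdom i hi j hj'

/-! ### The restricted isometry constant of a hyperplane projection -/

/-- For a projection onto a hyperplane, the isometry defect is a squared cosine. -/
theorem abs_defect_eq {E : Type*} [NormedAddCommGroup E] [InnerProductSpace ℝ E] (z x : E)
    (hx : x ≠ 0) :
    |‖(ContinuousLinearMap.id ℝ E - (ℝ ∙ z).starProjection) x‖ ^ 2 / ‖x‖ ^ 2 - 1| =
      ⟪z, x⟫_ℝ ^ 2 / (‖z‖ ^ 2 * ‖x‖ ^ 2) := by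
  have hx' : ‖x‖ ≠ 0 := norm_ne_zero_iff.2 hx
  rcases eq_or_ne z 0 with rfl | hz
  · simp [Submodule.span_zero_singleton, hx']
  have hz' : ‖z‖ ≠ 0 := norm_ne_zero_iff.2 hz
  have e : ‖(ContinuousLinearMap.id ℝ E - (ℝ ∙ z).starProjection) x‖ ^ 2 =
      ‖x‖ ^ 2 - ⟪z, x⟫_ℝ ^ 2 / ‖z‖ ^ 2 := by
    rw [sub_apply, ContinuousLinearMap.id_apply,
      Submodule.starProjection_singleton, norm_sub_sq_real, inner_smul_right, norm_smul,
      real_inner_comm, mul_pow, Real.norm_eq_abs, sq_abs]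
    simp only [RCLike.ofReal_real_eq_id, id]
    field_simp
    ring
  rw [e, show (‖x‖ ^ 2 - ⟪z, x⟫_ℝ ^ 2 / ‖z‖ ^ 2) / ‖x‖ ^ 2 - 1 =
    -(⟪z, x⟫_ℝ ^ 2 / (‖z‖ ^ 2 * ‖x‖ ^ 2)) by field_simp; ring, abs_neg, abs_of_nonneg]
  positivity

theorem ripConst_nonneg {E F : Type*} [NormedAddCommGroup E] [NormedSpace ℝ E]
    [NormedAddCommGroup F] [NormedSpace ℝ F] (S : Set E) (M : E →L[ℝ] F) : 0 ≤ ripConst S M :=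
  Real.iSup_nonneg fun _ => abs_nonneg _

theorem le_ripConst {E : Type*} [NormedAddCommGroup E] [InnerProductSpace ℝ E] {S : Set E}
    (z : E) {x : E} (hxS : x ∈ S - S) (hx : x ≠ 0) :
    ⟪z, x⟫_ℝ ^ 2 / (‖z‖ ^ 2 * ‖x‖ ^ 2) ≤
      ripConst S (ContinuousLinearMap.id ℝ E - (ℝ ∙ z).starProjection) := by
  rw [← abs_defect_eq z x hx]
  refine le_ciSup (f := fun x : {x : E // x ∈ S - S ∧ x ≠ 0} =>
    |‖(ContinuousLinearMap.id ℝ E - (ℝ ∙ z).starProjection) x‖ ^ 2 / ‖(x : E)‖ ^ 2 - 1|)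
    ⟨1, ?_⟩ ⟨x, hxS, hx⟩
  rintro _ ⟨⟨y, -, hy⟩, rfl⟩
  simp only
  rw [abs_defect_eq z y hy, ← mul_pow, ← sq_abs]
  refine div_le_one_of_le₀ ?_ (by positivity)
  exact pow_le_pow_left₀ (abs_nonneg _) (abs_real_inner_le_norm z y) 2

theorem ripConst_le {E : Type*} [NormedAddCommGroup E] [InnerProductSpace ℝ E] {S : Set E}
    (z : E) {c : ℝ} (hc : 0 ≤ c)
    (h : ∀ x ∈ S - S, ⟪z, x⟫_ℝ ^ 2 ≤ c * (‖z‖ ^ 2 * ‖x‖ ^ 2)) :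
    ripConst S (ContinuousLinearMap.id ℝ E - (ℝ ∙ z).starProjection) ≤ c := by
  refine Real.iSup_le ?_ hc
  rintro ⟨y, hyS, hy⟩
  simp only
  rw [abs_defect_eq z y hy]
  exact div_le_of_le_mul₀ (by positivity) hc (h y hyS)

theorem deltaNec_le {E : Type*} [NormedAddCommGroup E] [InnerProductSpace ℝ E] {S : Set E}
    {R : E → ℝ} {z : E} (hz : z ∈ descentConeOn R S) (hz0 : z ≠ 0) :
    deltaNec S R ≤ ripConst S (ContinuousLinearMap.id ℝ E - (ℝ ∙ z).starProjection) :=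
  ciInf_le (f := fun z : {z : E // z ∈ descentConeOn R S ∧ z ≠ 0} =>
    ripConst S (ContinuousLinearMap.id ℝ E - (ℝ ∙ (z : E)).starProjection))
    ⟨0, by rintro _ ⟨_, rfl⟩; exact ripConst_nonneg _ _⟩ ⟨z, hz, hz0⟩

/-! ### Vectors sparse in levels -/

section Levels

variable {L : ℕ} {n : Fin L → ℕ}

theorem levelSpace_norm_sq (z : LevelSpace n) : ‖z‖ ^ 2 = ∑ i, ∑ j, z i j ^ 2 := by
  rw [PiLp.norm_sq_eq_of_L2]
  simp only [EuclideanSpace.real_norm_sq_eq]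

theorem levelSpace_inner (z x : LevelSpace n) : ⟪z, x⟫_ℝ = ∑ i, ∑ j, z i j * x i j := by
  simp [PiLp.inner_apply, mul_comm]

/-- The restriction of `z` to the coordinates in `T i`, in each level `i`. -/
noncomputable def levelRestrict (T : ∀ i, Finset (Fin (n i))) (z : LevelSpace n) : LevelSpace n :=
  WithLp.toLp 2 fun i => WithLp.toLp 2 fun j => if j ∈ T i then z i j else 0

theorem levelRestrict_apply (T : ∀ i, Finset (Fin (n i))) (z : LevelSpace n) (i : Fin L)
    (j : Fin (n i)) : levelRestrict T z i j = if j ∈ T i then z i j else 0 := rfl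

theorem levelRestrict_mem {k : Fin L → ℕ} (T : ∀ i, Finset (Fin (n i)))
    (hT : ∀ i, (T i).card ≤ k i) (z : LevelSpace n) : levelRestrict T z ∈ sparseInLevels n k := by
  intro i
  refine le_trans ?_ (hT i)
  rw [← Set.ncard_coe_finset]
  refine Set.ncard_le_ncard (fun j hj => ?_) (Finset.finite_toSet _)
  by_contra h
  exact hj (by rw [levelRestrict_apply, if_neg (by simpa using h)])

theorem levelRestrict_norm_sq (T : ∀ i, Finset (Fin (n i))) (z : LevelSpace n) :
    ‖levelRestrict T z‖ ^ 2 = ∑ i, ∑ j ∈ T i, z i j ^ 2 := by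
  simp [levelSpace_norm_sq, levelRestrict_apply, ite_pow]

theorem inner_levelRestrict (T : ∀ i, Finset (Fin (n i))) (z : LevelSpace n) :
    ⟪z, levelRestrict T z⟫_ℝ = ‖levelRestrict T z‖ ^ 2 := by
  rw [levelRestrict_norm_sq, levelSpace_inner]
  simp [levelRestrict_apply, sq]

theorem levelRestrict_union_mem_sub {k : Fin L → ℕ} (T U : ∀ i, Finset (Fin (n i)))
    (hdisj : ∀ i, Disjoint (T i) (U i)) (hT : ∀ i, (T i).card ≤ k i) (hU : ∀ i, (U i).card ≤ k i)
    (z : LevelSpace n) :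
    levelRestrict (fun i => T i ∪ U i) z ∈ sparseInLevels n k - sparseInLevels n k := by
  refine ⟨levelRestrict T z, levelRestrict_mem T hT z, levelRestrict U (-z),
    levelRestrict_mem U hU _, ?_⟩
  ext i j
  have hj : j ∈ T i → j ∉ U i := fun h => Finset.disjoint_left.1 (hdisj i) h
  change levelRestrict T z i j - levelRestrict U (-z) i j = _
  simp only [levelRestrict_apply, PiLp.neg_apply, Finset.mem_union]
  by_cases h1 : j ∈ T i <;> by_cases h2 : j ∈ U i <;> simp_all

theorem support_sub_card_le {k : Fin L → ℕ} {x : LevelSpace n}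
    (hx : x ∈ sparseInLevels n k - sparseInLevels n k) (i : Fin L) :
    (Finset.univ.filter fun j => x i j ≠ 0).card ≤ 2 * k i := by
  obtain ⟨a, ha, b, hb, rfl⟩ := hx
  have h1 := ha i
  have h2 := hb i
  rw [← Set.ncard_coe_finset, two_mul]
  refine le_trans (Set.ncard_le_ncard ?_ (Set.toFinite _))
    ((Set.ncard_union_le _ _).trans (add_le_add h1 h2))
  intro j hj
  simp only [Finset.coe_filter, Finset.mem_univ, true_and, Set.mem_ofPred_eq] at hj
  simp only [Set.mem_union, Set.mem_ofPred_eq]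
  by_contra! h
  exact hj (by simp [h.1, h.2])

/-- A bound on the energy of `z` over all supports of `Σ - Σ` bounds its correlations with
`Σ - Σ`. -/
theorem ripConst_le_of_energy {k : Fin L → ℕ} (z : LevelSpace n) {c : ℝ} (hc : 0 ≤ c)
    (h : ∀ S : ∀ i, Finset (Fin (n i)), (∀ i, (S i).card ≤ 2 * k i) →
      ∑ i, ∑ j ∈ S i, z i j ^ 2 ≤ c * ‖z‖ ^ 2) :
    ripConst (sparseInLevels n k)
      (ContinuousLinearMap.id ℝ (LevelSpace n) - (ℝ ∙ z).starProjection) ≤ c := by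
  refine ripConst_le z hc fun x hx => ?_
  set S : ∀ i, Finset (Fin (n i)) := fun i => Finset.univ.filter fun j => x i j ≠ 0 with hS
  have hin : ⟪z, x⟫_ℝ = ⟪levelRestrict S z, x⟫_ℝ := by
    rw [levelSpace_inner, levelSpace_inner]
    refine Finset.sum_congr rfl fun i _ => Finset.sum_congr rfl fun j _ => ?_
    by_cases hj : x i j = 0
    · simp [hj]
    · rw [levelRestrict_apply, if_pos (by simp [hS, hj])]
  rw [hin, ← sq_abs]
  calc |⟪levelRestrict S z, x⟫_ℝ| ^ 2 ≤ (‖levelRestrict S z‖ * ‖x‖) ^ 2 :=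
        pow_le_pow_left₀ (abs_nonneg _) (abs_real_inner_le_norm _ _) 2
    _ = (∑ i, ∑ j ∈ S i, z i j ^ 2) * ‖x‖ ^ 2 := by rw [mul_pow, levelRestrict_norm_sq]
    _ ≤ c * ‖z‖ ^ 2 * ‖x‖ ^ 2 := by
        gcongr
        exact h S fun i => support_sub_card_le hx i
    _ = _ := by ring

/-- On the descent cone, the weighted `ℓ¹`-mass off suitable supports of full size `k i` does not
exceed the mass on them. -/
theorem descent_mass_le {k : Fin L → ℕ} (hn : ∀ i, k i ≤ n i) {w : Fin L → ℝ} (hw : ∀ i, 0 ≤ w i)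
    {x z : LevelSpace n} (hx : x ∈ sparseInLevels n k)
    (h : levelNorm n w (x + z) ≤ levelNorm n w x) :
    ∃ T : ∀ i, Finset (Fin (n i)), (∀ i, (T i).card = k i) ∧
      ∑ i, w i * ∑ j ∈ (T i)ᶜ, |z i j| ≤ ∑ i, w i * ∑ j ∈ T i, |z i j| := by
  have hT : ∀ i, ∃ T : Finset (Fin (n i)), (Finset.univ.filter fun j => x i j ≠ 0) ⊆ T ∧
      T.card = k i := by
    intro i
    apply Finset.exists_superset_card_eq
    · rw [← Set.ncard_coe_finset]
      refine le_trans (le_of_eq ?_) (hx i)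
      congr 1
      ext j; simp
    · simpa using hn i
  choose T hsub hcard using hT
  refine ⟨T, hcard, ?_⟩
  have key : ∀ i, ∑ j ∈ (T i)ᶜ, |z i j| - ∑ j ∈ T i, |z i j| ≤
      ∑ j, |(x + z) i j| - ∑ j, |x i j| := by
    intro i
    rw [← Finset.sum_add_sum_compl (T i) fun j => |(x + z) i j|,
      ← Finset.sum_add_sum_compl (T i) fun j => |x i j|]
    have hoff : ∀ j ∈ (T i)ᶜ, x i j = 0 := by
      intro j hj
      by_contra hne
      exact Finset.mem_compl.1 hj (hsub i (by simp [hne]))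
    have e1 : ∑ j ∈ (T i)ᶜ, |(x + z) i j| = ∑ j ∈ (T i)ᶜ, |z i j| :=
      Finset.sum_congr rfl fun j hj => by simp [hoff j hj]
    have e2 : ∑ j ∈ (T i)ᶜ, |x i j| = 0 := Finset.sum_eq_zero fun j hj => by simp [hoff j hj]
    have e3 : ∑ j ∈ T i, |x i j| - ∑ j ∈ T i, |z i j| ≤ ∑ j ∈ T i, |(x + z) i j| := by
      rw [← Finset.sum_sub_distrib]
      refine Finset.sum_le_sum fun j _ => ?_
      have := abs_sub_abs_le_abs_sub (x i j) (-z i j)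
      simpa using this
    linarith
  have := Finset.sum_le_sum fun i (_ : i ∈ Finset.univ) => mul_le_mul_of_nonneg_left (key i) (hw i)
  simp only [mul_sub, Finset.sum_sub_distrib] at this
  unfold levelNorm at h
  linarith

/-- The share of level `i` in `∑ i, w_i² k_i`. -/
noncomputable def levelShare (k : Fin L → ℕ) (w : Fin L → ℝ) (i : Fin L) : ℝ :=
  w i ^ 2 * k i / ∑ l, w l ^ 2 * k l

theorem levelShare_sum_pos {k : Fin L → ℕ} (hk : ∀ i, 0 < k i) {w : Fin L → ℝ}
    (hw : ∀ i, 0 < w i) (i : Fin L) : 0 < ∑ l, w l ^ 2 * (k l : ℝ) := by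
  refine Finset.sum_pos (fun l _ => ?_) ⟨i, Finset.mem_univ i⟩
  have := hw l
  have : (0 : ℝ) < k l := by exact_mod_cast hk l
  positivity

theorem levelShare_pos {k : Fin L → ℕ} (hk : ∀ i, 0 < k i) {w : Fin L → ℝ} (hw : ∀ i, 0 < w i)
    (i : Fin L) : 0 < levelShare k w i := by
  have h1 := levelShare_sum_pos hk hw i
  have := hw i
  have : (0 : ℝ) < k i := by exact_mod_cast hk i
  unfold levelShare
  positivity

/-! ### The lower bound for the compliance measure -/

/-- The one-level tail bounds add up: the weighted masses off the heads are bounded by those on the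
heads, and Cauchy–Schwarz bounds the latter by the energy of the heads. -/
theorem norm_sq_le_of_mass_le {k : Fin L → ℕ} (hk : ∀ i, 0 < k i) (hn : ∀ i, 2 * k i ≤ n i)
    {w : Fin L → ℝ} (hw : ∀ i, 0 < w i) {F : ℝ} (hF0 : 0 ≤ F)
    (hF : ∀ i, levelMax (k i) (levelShare k w i) ≤ F)
    (z : LevelSpace n) (T : ∀ i, Finset (Fin (n i))) (hT : ∀ i, (T i).card = k i)
    (h : ∑ i, w i * ∑ j ∈ (T i)ᶜ, |z i j| ≤ ∑ i, w i * ∑ j ∈ T i, |z i j|) :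
    ∃ x ∈ sparseInLevels n k - sparseInLevels n k, ⟪z, x⟫_ℝ = ‖x‖ ^ 2 ∧
      ‖z‖ ^ 2 ≤ (1 + F) * ‖x‖ ^ 2 := by
  have hU : ∀ i, ∃ U ⊆ (T i)ᶜ, U.card = k i ∧ ∀ a ∈ U, ∀ b ∈ (T i)ᶜ \ U, |z i b| ≤ |z i a| := by
    intro i
    refine exists_top_subset (fun j => |z i j|) _ ?_
    rw [Finset.card_compl, hT i, Fintype.card_fin]
    have := hn i
    omega
  choose U hUT hU hdom using hU
  have hdisj : ∀ i, Disjoint (T i) (U i) := fun i =>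
    Finset.disjoint_left.2 fun j h1 h2 => Finset.mem_compl.1 (hUT i h2) h1
  refine ⟨levelRestrict (fun i => T i ∪ U i) z,
    levelRestrict_union_mem_sub T U hdisj (fun i => (hT i).le) (fun i => (hU i).le) z,
    inner_levelRestrict _ _, ?_⟩
  rw [levelRestrict_norm_sq, levelSpace_norm_sq]
  have hsplit : ∀ i, ∑ j, z i j ^ 2 = ∑ j ∈ T i, z i j ^ 2 + ∑ j ∈ U i, z i j ^ 2 +
      ∑ j ∈ (T i)ᶜ \ U i, z i j ^ 2 := by
    intro i
    rw [← Finset.sum_add_sum_compl (T i), add_assoc, add_comm (∑ j ∈ U i, z i j ^ 2),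
      Finset.sum_sdiff (hUT i)]
  have hTU : ∀ i, ∑ j ∈ T i ∪ U i, z i j ^ 2 =
      ∑ j ∈ T i, z i j ^ 2 + ∑ j ∈ U i, z i j ^ 2 := fun i => Finset.sum_union (hdisj i)
  simp only [hsplit, hTU, Finset.sum_add_distrib]
  set W := ∑ l, w l ^ 2 * (k l : ℝ)
  have hW0 : 0 ≤ W := Finset.sum_nonneg fun l _ => by positivity
  -- the tail bound in each level
  have htail : ∀ i, ∑ j ∈ (T i)ᶜ \ U i, z i j ^ 2 ≤
      F * ((w i * ∑ j ∈ (T i)ᶜ, |z i j|) ^ 2 / W + ∑ j ∈ U i, z i j ^ 2) := by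
    intro i
    have ht := tail_sq_le (hk i) (levelShare_pos hk hw i) (U i) ((T i)ᶜ \ U i) (hU i)
      Finset.disjoint_sdiff (fun j => |z i j|) (fun j => abs_nonneg _) (hdom i)
    simp only [sq_abs, Finset.union_sdiff_of_subset (hUT i)] at ht
    have hki : (0 : ℝ) < k i := by exact_mod_cast hk i
    have e : levelShare k w i / k i * (∑ j ∈ (T i)ᶜ, |z i j|) ^ 2 =
        (w i * ∑ j ∈ (T i)ᶜ, |z i j|) ^ 2 / W := by
      unfold levelShare
      field_simp
      ring
    rw [e] at ht
    refine ht.trans (mul_le_mul_of_nonneg_right (hF i) ?_)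
    exact add_nonneg (by positivity) (Finset.sum_nonneg fun j _ => sq_nonneg _)
  -- the cross terms between levels are nonnegative
  have hcross : ∑ i, (w i * ∑ j ∈ (T i)ᶜ, |z i j|) ^ 2 ≤
      (∑ i, w i * ∑ j ∈ (T i)ᶜ, |z i j|) ^ 2 :=
    Finset.sum_sq_le_sq_sum_of_nonneg fun i _ =>
      mul_nonneg (hw i).le (Finset.sum_nonneg fun j _ => abs_nonneg _)
  have hhead : (∑ i, w i * ∑ j ∈ T i, |z i j|) ^ 2 ≤ W * ∑ i, ∑ j ∈ T i, z i j ^ 2 := by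
    refine Finset.sum_sq_le_sum_mul_sum_of_sq_le_mul _ (fun i _ => by positivity)
      (fun i _ => Finset.sum_nonneg fun j _ => sq_nonneg _) fun i _ => ?_
    have := sq_sum_le_card_mul_sum_sq (s := T i) (f := fun j => |z i j|)
    simp only [sq_abs, hT i] at this
    rw [mul_pow, mul_assoc]
    gcongr
  have hsq : (∑ i, w i * ∑ j ∈ (T i)ᶜ, |z i j|) ^ 2 ≤ (∑ i, w i * ∑ j ∈ T i, |z i j|) ^ 2 :=
    pow_le_pow_left₀ (Finset.sum_nonneg fun i _ =>
      mul_nonneg (hw i).le (Finset.sum_nonneg fun j _ => abs_nonneg _)) h 2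
  have hsum : ∑ i, ∑ j ∈ (T i)ᶜ \ U i, z i j ^ 2 ≤
      F * (∑ i, ∑ j ∈ T i, z i j ^ 2 + ∑ i, ∑ j ∈ U i, z i j ^ 2) := by
    refine (Finset.sum_le_sum fun i _ => htail i).trans ?_
    rw [← Finset.mul_sum, Finset.sum_add_distrib, ← Finset.sum_div]
    gcongr
    refine div_le_of_le_mul₀ hW0 (Finset.sum_nonneg fun i _ =>
      Finset.sum_nonneg fun j _ => sq_nonneg _) ?_
    rw [mul_comm]
    exact hcross.trans (hsq.trans hhead)
  linarith

theorem le_deltaNec {k : Fin L → ℕ} (hk : ∀ i, 0 < k i) (hn : ∀ i, 2 * k i ≤ n i)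
    {w : Fin L → ℝ} (hw : ∀ i, 0 < w i) {F : ℝ} (hF0 : 0 ≤ F)
    (hF : ∀ i, levelMax (k i) (levelShare k w i) ≤ F)
    (hne : ∃ z ∈ descentConeOn (levelNorm n w) (sparseInLevels n k), z ≠ 0) :
    1 / (1 + F) ≤ deltaNec (sparseInLevels n k) (levelNorm n w) := by
  obtain ⟨z₀, hz₀, hz₀'⟩ := hne
  have : Nonempty {z : LevelSpace n //
      z ∈ descentConeOn (levelNorm n w) (sparseInLevels n k) ∧ z ≠ 0} := ⟨⟨z₀, hz₀, hz₀'⟩⟩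
  refine le_ciInf ?_
  rintro ⟨z, hz, hz0⟩
  simp only [descentConeOn, descentCone, Set.mem_iUnion, Set.mem_ofPred_eq] at hz
  obtain ⟨y, hy, γ, v, hv, rfl⟩ := hz
  obtain ⟨T, hT, hmass⟩ := descent_mass_le (fun i => by have := hn i; omega)
    (fun i => (hw i).le) hy hv
  -- the mass inequality is homogeneous in the direction
  have hmass' : ∑ i, w i * ∑ j ∈ (T i)ᶜ, |(γ • v) i j| ≤
      ∑ i, w i * ∑ j ∈ T i, |(γ • v) i j| := by
    have e : ∀ S : ∀ i, Finset (Fin (n i)), ∑ i, w i * ∑ j ∈ S i, |(γ • v) i j| =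
        |γ| * ∑ i, w i * ∑ j ∈ S i, |v i j| := by
      intro S
      simp only [PiLp.smul_apply, smul_eq_mul, abs_mul, ← Finset.mul_sum]
      rw [Finset.mul_sum]
      exact Finset.sum_congr rfl fun i _ => by ring
    rw [e T, e fun i => (T i)ᶜ]
    exact mul_le_mul_of_nonneg_left hmass (abs_nonneg γ)
  obtain ⟨x, hxS, hin, hle⟩ := norm_sq_le_of_mass_le hk hn hw hF0 hF _ T hT hmass'
  set z := γ • v
  have hzp : 0 < ‖z‖ ^ 2 := by have := norm_pos_iff.2 hz0; positivity
  have hx0 : x ≠ 0 := by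
    rintro rfl
    simp at hle
    exact hz0 hle
  have hxp : 0 < ‖x‖ ^ 2 := by have := norm_pos_iff.2 hx0; positivity
  refine le_trans ?_ (le_ripConst z hxS hx0)
  rw [hin, div_le_div_iff₀ (by positivity) (by positivity)]
  nlinarith

end Levels

/-! ### The upper bound for the compliance measure -/

section Witness

variable {L : ℕ} {n : Fin L → ℕ}

/-- The extremal vectors: heights `a l` on `k l` entries of each level `l`, and `1` on `k i + x`
further entries of the level `i`. -/
theorem exists_descent_ripConst_le {k : Fin L → ℕ} (hk : ∀ l, 0 < k l) (hn : ∀ l, k l ≤ n l)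
    {w : Fin L → ℝ} (i : Fin L) (x : ℕ) (hx : 2 * k i + x ≤ n i) {a : Fin L → ℝ}
    (ha : ∀ l, 0 ≤ a l) (hai : 1 ≤ a i) (hmass : w i * (k i + x) ≤ ∑ l, w l * (k l * a l)) :
    ∃ z ∈ descentConeOn (levelNorm n w) (sparseInLevels n k), z ≠ 0 ∧
      ripConst (sparseInLevels n k)
        (ContinuousLinearMap.id ℝ (LevelSpace n) - (ℝ ∙ z).starProjection) ≤
        (∑ l, k l * a l ^ 2 + k i) / (∑ l, k l * a l ^ 2 + k i + x) := by
  have hT : ∀ l, ∃ T : Finset (Fin (n l)), T.card = k l := fun l => by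
    obtain ⟨T, -, hT⟩ := Finset.exists_subset_card_eq
      (s := (Finset.univ : Finset (Fin (n l)))) (n := k l) (by simpa using hn l)
    exact ⟨T, hT⟩
  choose T hT using hT
  have hP : ∀ l, ∃ P ⊆ (T l)ᶜ, P.card = if l = i then k l + x else 0 := fun l => by
    refine Finset.exists_subset_card_eq ?_
    rw [Finset.card_compl, hT, Fintype.card_fin]
    split_ifs with h
    · subst h; omega
    · omega
  choose P hPT hP using hP
  have hoff : ∀ l j, j ∈ P l → j ∉ T l := fun l j hj => Finset.mem_compl.1 (hPT l hj)
  set u : LevelSpace n := WithLp.toLp 2 fun l => WithLp.toLp 2 fun j => if j ∈ T l then a l else 0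
    with hu
  set v : LevelSpace n := WithLp.toLp 2 fun l => WithLp.toLp 2 fun j => if j ∈ P l then 1 else 0
    with hv
  have hu' : ∀ l j, u l j = if j ∈ T l then a l else 0 := fun _ _ => rfl
  have hv' : ∀ l j, v l j = if j ∈ P l then 1 else 0 := fun _ _ => rfl
  have hz : ∀ l j, (u + v) l j ^ 2 = (if j ∈ T l then a l ^ 2 else 0) +
      if j ∈ P l then 1 else 0 := by
    intro l j
    simp only [PiLp.add_apply, hu', hv']
    have := hoff l j
    by_cases h1 : j ∈ P l
    · simp [h1, this h1]
    · simp [h1]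
  set E : ℝ := ∑ l, k l * a l ^ 2 + k i with hE
  have hki : (0 : ℝ) < k i := by exact_mod_cast hk i
  have hE0 : 0 < E := by
    have : 0 ≤ ∑ l, k l * a l ^ 2 := Finset.sum_nonneg fun l _ => by positivity
    linarith
  have hnorm : ‖u + v‖ ^ 2 = E + x := by
    rw [levelSpace_norm_sq]
    simp only [hz, Finset.sum_add_distrib, Finset.sum_ite_mem, Finset.univ_inter,
      Finset.sum_const, hT, hP, nsmul_eq_mul, mul_one]
    simp [hE, add_assoc]
  have hz0 : u + v ≠ 0 := by
    intro h
    rw [h] at hnorm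
    simp at hnorm
    have : (0 : ℝ) ≤ x := Nat.cast_nonneg x
    linarith
  refine ⟨u + v, ?_, hz0, ripConst_le_of_energy _ (by positivity) fun S hS => ?_⟩
  · -- the descent starts from minus the head
    simp only [descentConeOn, descentCone, Set.mem_iUnion, Set.mem_ofPred_eq]
    refine ⟨-u, ?_, 1, u + v, ?_, by simp⟩
    · have : -u = levelRestrict T (-u) := by
        ext l j
        simp only [levelRestrict_apply, PiLp.neg_apply, hu']
        by_cases h : j ∈ T l <;> simp [h]
      rw [this]
      exact levelRestrict_mem T (fun l => (hT l).le) _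
    · rw [neg_add_cancel_left]
      have e1 : levelNorm n w v = w i * (k i + x) := by
        unfold levelNorm
        simp [hv', apply_ite abs, hP]
      have e2 : levelNorm n w (-u) = ∑ l, w l * (k l * a l) := by
        unfold levelNorm
        simp [hu', apply_ite abs, hT, abs_of_nonneg (ha _)]
      rw [e1, e2]
      exact hmass
  · rw [hnorm, div_mul_cancel₀ _ (by positivity)]
    have hlev : ∀ l, ∑ j ∈ S l, (u + v) l j ^ 2 ≤
        k l * a l ^ 2 + if l = i then (k l : ℝ) else 0 := by
      intro l
      simp only [hz, Finset.sum_add_distrib, Finset.sum_ite_mem, Finset.sum_const, nsmul_eq_mul,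
        mul_one]
      have h1 : (S l ∩ T l).card ≤ k l := (Finset.card_le_card Finset.inter_subset_right).trans
        (hT l).le
      have h1' : ((S l ∩ T l).card : ℝ) ≤ k l := by exact_mod_cast h1
      split_ifs with h
      · subst h
        have h2 : (S l ∩ T l).card + (S l ∩ P l).card ≤ 2 * k l := by
          rw [← Finset.card_union_of_disjoint]
          · exact (Finset.card_le_card
              (Finset.union_subset Finset.inter_subset_left Finset.inter_subset_left)).trans (hS l)
          · refine Finset.disjoint_left.2 fun j hj hj' => ?_
            exact hoff l j (Finset.mem_inter.1 hj').2 (Finset.mem_inter.1 hj).2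
        have h2' : ((S l ∩ T l).card : ℝ) + (S l ∩ P l).card ≤ 2 * k l := by exact_mod_cast h2
        -- replacing tail entries by head entries only increases the energy, as `1 ≤ a l`
        nlinarith [mul_nonneg (sub_nonneg.2 h1') (sub_nonneg.2 (one_le_pow₀ hai (n := 2)))]
      · have h2 : (S l ∩ P l).card = 0 := by
          have := (Finset.card_le_card (Finset.inter_subset_right (s₁ := S l) (s₂ := P l))).trans
            (hP l).le
          simpa [h] using this
        rw [h2]
        simp only [Nat.cast_zero, add_zero]
        gcongr
    refine (Finset.sum_le_sum fun l _ => hlev l).trans_eq ?_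
    rw [Finset.sum_add_distrib]
    simp [hE]

theorem deltaNec_le_of_heights {k : Fin L → ℕ} (hk : ∀ l, 0 < k l) (hn : ∀ l, k l ≤ n l)
    {w : Fin L → ℝ} (i : Fin L) (x : ℕ) (hx : 2 * k i + x ≤ n i) {a : Fin L → ℝ}
    (ha : ∀ l, 0 ≤ a l) (hai : 1 ≤ a i) (hmass : w i * (k i + x) ≤ ∑ l, w l * (k l * a l)) :
    deltaNec (sparseInLevels n k) (levelNorm n w) ≤
        (∑ l, k l * a l ^ 2 + k i) / (∑ l, k l * a l ^ 2 + k i + x) := by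
  obtain ⟨z, hz, hz0, hle⟩ := exists_descent_ripConst_le hk hn i x hx ha hai hmass
  exact (deltaNec_le hz hz0).trans hle

/-- Heights proportional to the weights are the equality case of Cauchy–Schwarz and produce the
ratio of a single level with its share as parameter. -/
theorem deltaNec_le_levelRatio {k : Fin L → ℕ} (hk : ∀ l, 0 < k l) (hn : ∀ l, k l ≤ n l)
    {w : Fin L → ℝ} (hw : ∀ l, 0 < w l) (i : Fin L) (x : ℕ) (hx : 2 * k i + x ≤ n i)
    (hshare : (k i : ℝ) ≤ levelShare k w i * (k i + x)) :
    deltaNec (sparseInLevels n k) (levelNorm n w) ≤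
      1 / (1 + levelRatio (k i) (levelShare k w i) x) := by
  set W := ∑ l, w l ^ 2 * (k l : ℝ) with hWdef
  have hW : 0 < W := levelShare_sum_pos hk hw i
  have hki : (0 : ℝ) < k i := by exact_mod_cast hk i
  have hwi := hw i
  set c : ℝ := w i * (k i + x) / W with hc
  have hc0 : 0 ≤ c := by positivity
  have hνeq : levelShare k w i = w i ^ 2 * k i / W := rfl
  have h := deltaNec_le_of_heights hk hn (w := w) i x hx (a := fun l => c * w l)
    (fun l => mul_nonneg hc0 (hw l).le) ?_ ?_
  · refine h.trans_eq ?_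
    have e : ∑ l, (k l : ℝ) * (c * w l) ^ 2 = c ^ 2 * W := by
      rw [hWdef, Finset.mul_sum]
      exact Finset.sum_congr rfl fun l _ => by ring
    have e2 : c ^ 2 * W = levelShare k w i * (x / k i + 1) ^ 2 * k i := by
      rw [hνeq, hc]
      field_simp
      ring
    have hν := levelShare_pos hk hw i
    rw [e, e2]
    unfold levelRatio
    field_simp
  · have e : c * w i = levelShare k w i * (k i + x) / k i := by
      rw [hνeq, hc]; field_simp
    rw [e, one_le_div hki]
    exact hshare
  · apply le_of_eq
    have e : ∑ l, w l * ((k l : ℝ) * (c * w l)) = c * W := by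
      rw [hWdef, Finset.mul_sum]
      exact Finset.sum_congr rfl fun l _ => by ring
    rw [e, hc]
    field_simp

end Witness

/-! ### Two levels -/

section TwoLevels

variable {k n : Fin 2 → ℕ}

theorem sum_fin_two_of_ne {i j : Fin 2} (hij : i ≠ j) (f : Fin 2 → ℝ) :
    ∑ l, f l = f i + f j := by
  fin_cases i <;> fin_cases j <;> simp_all [add_comm]

theorem levelShare_add {i j : Fin 2} (hij : i ≠ j) (hk : ∀ l, 0 < k l) {w : Fin 2 → ℝ}
    (hw : ∀ l, 0 < w l) : levelShare k w i + levelShare k w j = 1 := by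
  have hW := levelShare_sum_pos hk hw i
  unfold levelShare
  rw [← add_div, div_eq_one_iff_eq hW.ne', sum_fin_two_of_ne hij]

/-- A level with a small share is a bad one: its own tail, supported by the heads of the other
level, keeps the compliance measure below its value at the best balance. -/
theorem deltaNec_lt_of_share_small (hk : ∀ l, 0 < k l) (hn : ∀ l, 4 * k l ≤ n l)
    {w : Fin 2 → ℝ} (hw : ∀ l, 0 < w l) {i j : Fin 2} (hij : i ≠ j)
    (hs : levelShare k w i < 2 * √3 - 3) :
    deltaNec (sparseInLevels n k) (levelNorm n w) < 1 / (1 + (√3 - 1) / 2) := by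
  have hki : (0 : ℝ) < k i := by exact_mod_cast hk i
  have hkj : (0 : ℝ) < k j := by exact_mod_cast hk j
  have hν := levelShare_pos hk hw i
  have ha := two_sqrt_three_sub_three_bounds.2
  have h3 : √3 ^ 2 = 3 := Real.sq_sqrt (by norm_num)
  have h31 : 1 < √3 := Real.lt_sqrt (by norm_num) |>.2 (by norm_num)
  have hn' : ∀ l, k l ≤ n l := fun l => by have := hn l; omega
  have hx : 2 * k i + 2 * k i ≤ n i := by have := hn i; omega
  rcases le_total (1 / 3) (levelShare k w i) with h | h
  · refine (deltaNec_le_levelRatio hk hn' hw i (2 * k i) hx ?_).trans_lt ?_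
    · push_cast; nlinarith
    · gcongr
      unfold levelRatio
      push_cast
      rw [mul_div_cancel_right₀ _ hki.ne', lt_div_iff₀ (by positivity)]
      nlinarith
  · -- the head of level `i` has height `1`, and the other level makes up for the missing mass
    have hwi := hw i
    have hwj := hw j
    set t : ℝ := 2 * w i * k i / (w j * k j) with ht
    have ht0 : 0 ≤ t := by positivity
    set a : Fin 2 → ℝ := fun l => if l = i then 1 else t with haa
    have hai : a i = 1 := by simp [haa]
    have haj : a j = t := by simp [haa, hij.symm]
    refine (deltaNec_le_of_heights hk hn' (w := w) i (2 * k i) hx (a := a) ?_ hai.ge ?_).trans_lt ?_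
    · intro l; simp only [haa]; split_ifs <;> positivity
    · rw [sum_fin_two_of_ne hij, hai, haj, ht]
      apply le_of_eq
      push_cast
      field_simp
    · rw [sum_fin_two_of_ne hij, hai, haj]
      -- the head of level `j` has energy `4 k_i ν / (1 - ν) ≤ 2 k_i`
      have hs' : levelShare k w i = w i ^ 2 * k i / (w i ^ 2 * k i + w j ^ 2 * k j) := by
        unfold levelShare; rw [sum_fin_two_of_ne hij]
      rw [hs', div_le_iff₀ (by positivity)] at h
      have hE : k j * t ^ 2 ≤ 2 * k i := by
        have e : k j * t ^ 2 = 4 * w i ^ 2 * k i ^ 2 / (w j ^ 2 * k j) := by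
          rw [ht]; field_simp; ring
        rw [e, div_le_iff₀ (by positivity)]
        nlinarith
      have hE0 : 0 ≤ k j * t ^ 2 := by positivity
      push_cast
      rw [div_lt_div_iff₀ (by positivity) (by positivity)]
      nlinarith

/-- At shares that are not too small, the compliance measure is at most the value given by the
optimal integer tail length. -/
theorem deltaNec_le_levelMax (hk : ∀ l, 2 ≤ k l) (hn : ∀ l, 4 * k l ≤ n l)
    {w : Fin 2 → ℝ} (hw : ∀ l, 0 < w l) (i : Fin 2)
    (hs : 2 * √3 - 3 ≤ levelShare k w i) (hs' : levelShare k w i ≤ 1 - (2 * √3 - 3)) :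
    deltaNec (sparseInLevels n k) (levelNorm n w) ≤
      1 / (1 + levelMax (k i) (levelShare k w i)) := by
  have hk0 : ∀ l, 0 < k l := fun l => by have := hk l; omega
  have ha := two_sqrt_three_sub_three_bounds.1
  set ν := levelShare k w i
  have hν : 0 < ν := by linarith
  obtain ⟨x, hxeq, -, hlow, hup⟩ := exists_levelMax_eq (k := k i) hν
  have hx2 := hup (by linarith)
  have hk2 : (2 : ℝ) ≤ k i := by exact_mod_cast hk i
  have hsq : (1.69 : ℝ) ≤ √(1 + 1 / ν) := by
    apply Real.le_sqrt_of_sq_le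
    have : 1 / 0.536 ≤ 1 / ν := one_div_le_one_div_of_le hν (by linarith)
    norm_num at this ⊢
    linarith
  rw [hxeq]
  refine deltaNec_le_levelRatio hk0 (fun l => by have := hn l; omega) hw i x
    (by have := hn i; omega) ?_
  have hx1 : 1.19 * (k i : ℝ) ≤ x := by nlinarith
  change (k i : ℝ) ≤ ν * (k i + x)
  nlinarith

theorem deltaNec_le_levelObjective (hk : ∀ l, 2 ≤ k l) (hn : ∀ l, 4 * k l ≤ n l)
    {w : Fin 2 → ℝ} (hw : ∀ l, 0 < w l)
    (hs : levelShare k w 0 ∈ Set.Icc (2 * √3 - 3) (1 - (2 * √3 - 3))) :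
    deltaNec (sparseInLevels n k) (levelNorm n w) ≤
      1 / (1 + levelObjective k (levelShare k w 0)) := by
  have hadd := levelShare_add (k := k) (i := 0) (j := 1) (by decide)
    (fun l => by have := hk l; omega) hw
  have e : 1 - levelShare k w 0 = levelShare k w 1 := by linarith
  unfold levelObjective
  rw [e]
  rcases max_choice (levelMax (k 0) (levelShare k w 0)) (levelMax (k 1) (levelShare k w 1))
    with h | h <;> rw [h]
  · exact deltaNec_le_levelMax hk hn hw 0 hs.1 hs.2
  · exact deltaNec_le_levelMax hk hn hw 1 (by linarith [hs.2]) (by linarith [hs.1])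

theorem levelObjective_le_deltaNec (hk : ∀ l, 0 < k l) (hn : ∀ l, 2 * k l ≤ n l)
    {w : Fin 2 → ℝ} (hw : ∀ l, 0 < w l) :
    1 / (1 + levelObjective k (levelShare k w 0)) ≤
      deltaNec (sparseInLevels n k) (levelNorm n w) := by
  have hadd := levelShare_add (k := k) (i := 0) (j := 1) (by decide) hk hw
  have e : 1 - levelShare k w 0 = levelShare k w 1 := by linarith
  have hF : ∀ i, levelMax (k i) (levelShare k w i) ≤ levelObjective k (levelShare k w 0) := by
    unfold levelObjective
    rw [e]
    intro i
    fin_cases i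
    · exact le_max_left _ _
    · exact le_max_right _ _
  refine le_deltaNec hk hn hw ((levelMax_nonneg _ (levelShare_pos hk hw 0).le).trans (hF 0)) hF ?_
  obtain ⟨z, hz, hz0, -⟩ := exists_descent_ripConst_le (k := k) (n := n) (w := w) hk
    (fun l => by have := hn l; omega) 0 0 (by simpa using hn 0) (a := fun _ => 1) (by simp)
    le_rfl (by
      have := mul_nonneg (hw 1).le (Nat.cast_nonneg (k 1) : (0 : ℝ) ≤ k 1)
      simpa [Fin.sum_univ_two] using this)
  exact ⟨z, hz, hz0⟩

/-- The share of level `0` and the ratio of the weights determine each other. -/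
theorem levelShare_zero_eq_iff (hk : ∀ l, 0 < k l) {w : Fin 2 → ℝ} (hw : ∀ l, 0 < w l) {ν : ℝ}
    (hν : 0 < ν) (hν1 : ν ≤ 1) :
    levelShare k w 0 = ν ↔ w 1 / w 0 = √((k 0 : ℝ) / k 1 * (1 / ν - 1)) := by
  have h0 := hw 0
  have h1 := hw 1
  have hk0 : (0 : ℝ) < k 0 := by exact_mod_cast hk 0
  have hk1 : (0 : ℝ) < k 1 := by exact_mod_cast hk 1
  have hν' : 0 ≤ 1 / ν - 1 := by rw [sub_nonneg, le_div_iff₀ hν]; linarith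
  rw [eq_comm (a := w 1 / w 0), Real.sqrt_eq_iff_eq_sq (by positivity) (by positivity)]
  unfold levelShare
  rw [Fin.sum_univ_two, div_pow, div_eq_iff (by positivity), eq_div_iff (by positivity)]
  field_simp
  constructor <;> intro h <;> linarith

theorem isMaxOn_deltaNec_iff (hk : ∀ l, 2 ≤ k l) (hn : ∀ l, 4 * k l ≤ n l) {ν : ℝ}
    (hν : ν ∈ Set.Icc (2 * √3 - 3) (1 - (2 * √3 - 3)))
    (hmin : IsMinOn (levelObjective k) (Set.Icc (2 * √3 - 3) (1 - (2 * √3 - 3))) ν)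
    {w : Fin 2 → ℝ} (hw : ∀ l, 0 < w l) :
    IsMaxOn (fun v => deltaNec (sparseInLevels n k) (levelNorm n v))
        {v : Fin 2 → ℝ | ∀ i, 0 < v i} w ↔ levelShare k w 0 = ν := by
  have hk0 : ∀ l, 0 < k l := fun l => by have := hk l; omega
  have hn2 : ∀ l, 2 * k l ≤ n l := fun l => by have := hn l; omega
  obtain ⟨ha, ha'⟩ := two_sqrt_three_sub_three_bounds
  have hν0 : 0 < ν := by linarith [hν.1]
  have hν1 : ν < 1 := by linarith [hν.2]
  have hF0 : 0 ≤ levelObjective k ν := le_max_of_le_left (levelMax_nonneg _ hν0.le)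
  have hhalf : levelObjective k ν ≤ (√3 - 1) / 2 :=
    (hmin ⟨by linarith, by linarith⟩).trans (levelObjective_half_le k)
  -- every other share does strictly worse than the bound at `ν`
  have hlt : ∀ v : Fin 2 → ℝ, (∀ l, 0 < v l) → levelShare k v 0 ≠ ν →
      deltaNec (sparseInLevels n k) (levelNorm n v) < 1 / (1 + levelObjective k ν) := by
    intro v hv hne
    have hadd := levelShare_add (k := k) (i := 0) (j := 1) (by decide) hk0 hv
    have hout : 1 / (1 + (√3 - 1) / 2) ≤ 1 / (1 + levelObjective k ν) := by gcongr
    by_cases h1 : levelShare k v 0 < 2 * √3 - 3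
    · exact (deltaNec_lt_of_share_small hk0 hn hv (j := 1) (by decide) h1).trans_le hout
    by_cases h2 : levelShare k v 1 < 2 * √3 - 3
    · exact (deltaNec_lt_of_share_small hk0 hn hv (j := 0) (by decide) h2).trans_le hout
    have hmem : levelShare k v 0 ∈ Set.Icc (2 * √3 - 3) (1 - (2 * √3 - 3)) :=
      ⟨by linarith, by linarith⟩
    refine (deltaNec_le_levelObjective hk hn hv hmem).trans_lt ?_
    have := levelObjective_lt_of_isMinOn hk0 (by linarith) hν hmin hmem hne
    gcongr
  have hge : ∀ v : Fin 2 → ℝ, (∀ l, 0 < v l) → levelShare k v 0 = ν →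
      1 / (1 + levelObjective k ν) ≤ deltaNec (sparseInLevels n k) (levelNorm n v) :=
    fun v hv h => h ▸ levelObjective_le_deltaNec hk0 hn2 hv
  constructor
  · intro hmax
    by_contra hne
    -- weights with share exactly `ν`
    obtain ⟨v, hv, hvν⟩ : ∃ v : Fin 2 → ℝ, (∀ l, 0 < v l) ∧ levelShare k v 0 = ν := by
      have hk0' : (0 : ℝ) < k 0 := by exact_mod_cast hk0 0
      have hk1' : (0 : ℝ) < k 1 := by exact_mod_cast hk0 1
      have h1 : 0 < 1 / ν - 1 := by rw [sub_pos, lt_div_iff₀ hν0]; linarith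
      have hv : ∀ l, 0 < (![1, √((k 0 : ℝ) / k 1 * (1 / ν - 1))] : Fin 2 → ℝ) l := by
        rw [Fin.forall_fin_two]
        exact ⟨one_pos, Real.sqrt_pos.2 (by positivity)⟩
      exact ⟨_, hv, (levelShare_zero_eq_iff hk0 hv hν0 hν1.le).2 (by simp)⟩
    exact absurd (hmax hv) (not_le.2 ((hlt w hw hne).trans_le (hge v hv hvν)))
  · intro h v hv
    refine le_trans ?_ (hge w hw h)
    by_cases hvν : levelShare k v 0 = ν
    · have := deltaNec_le_levelObjective hk hn hv (hvν ▸ hν)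
      rwa [hvν] at this
    · exact (hlt v hv hvν).le

end TwoLevels

theorem mainTheorem5 (k n : Fin 2 → ℕ) (hk : ∀ i, 2 ≤ k i) (hn : ∀ i, 4 * k i ≤ n i) :
    (∃ ν ∈ Set.Icc (2 * √3 - 3 : ℝ) (1 - (2 * √3 - 3)),
      IsMinOn (levelObjective k) (Set.Icc (2 * √3 - 3 : ℝ) (1 - (2 * √3 - 3))) ν) ∧
    ∀ ν ∈ Set.Icc (2 * √3 - 3 : ℝ) (1 - (2 * √3 - 3)),
      IsMinOn (levelObjective k) (Set.Icc (2 * √3 - 3 : ℝ) (1 - (2 * √3 - 3))) ν →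
      ∀ w : Fin 2 → ℝ, (∀ i, 0 < w i) →
        (IsMaxOn (fun v => deltaNec (sparseInLevels n k) (levelNorm n v))
            {v : Fin 2 → ℝ | ∀ i, 0 < v i} w ↔
          w 1 / w 0 = √((k 0 : ℝ) / k 1 * (1 / ν - 1))) := by
  have hk0 : ∀ i, 0 < k i := fun i => by have := hk i; omega
  obtain ⟨ha, ha'⟩ := two_sqrt_three_sub_three_bounds
  refine ⟨levelObjective_exists_isMinOn hk0 (by linarith) (by linarith), ?_⟩
  intro ν hν hmin w hw
  rw [isMaxOn_deltaNec_iff hk hn hν hmin hw]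
  exact levelShare_zero_eq_iff hk0 hw (by linarith [hν.1]) (by linarith [hν.2])
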